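/- A topological semigroup is a nonempty Hausdorff topological space with a continuous associative multiplication. A space $X$ is pseudocompact if it is Tychonoff and every continuous function $X\to\mathbb R$ is bounded. A semigroup $S$ is simple if it contains no nonempty two-sided ideal other than $S$ itself. It is completely simple if it is simple and contains a primitive idempotent, i.e. a minimal element of the set $E=\{e\in S: ee=e\}$ of idempotents with respect to the partial order $e\le f\iff ef=fe=e$. For a group $H$, sets $X,Y$ and a map $\sigma:Y\times X\to H$, the Rees product $[X,H,Y]_\sigma$ is the set $X\times H\times Y$ with the multiplication $(x,h,y)(x',h',y')=(x,h\,\sigma(y,x')\,h',y')$. A topological semigroup is a topological paragroup if it is topologically isomorphic to a Rees product $[X,H,Y]_\sigma$, with the product topology, for some Hausdorff topological group $H$, Hausdorff spaces $X,Y$ and a continuous map $\sigma:Y\times X\to H$. Theorem. Let $S$ be a pseudocompact topological semigroup. Then $S$ is a topological paragroup if and only if $S$ is completely simple. Moreover, if $S$ is completely simple, then for every idempotent $e\in S$ the maximal subgroup $H_e=eSe$, with the multiplication and topology induced from $S$, is a pseudocompact topological group. -/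

import Mathlib

universe u v w

/-- A semigroup is simple if it contains no proper two-sided ideal: every nonempty subset that
absorbs multiplication from the left and from the right is the whole semigroup. -/
def IsSimpleSemigroup (S : Type u) [Semigroup S] : Prop :=
  ∀ I : Set S, I.Nonempty → (∀ s : S, ∀ a ∈ I, s * a ∈ I ∧ a * s ∈ I) → I = Set.univ

/-- An idempotent `e` is primitive if it is minimal among the idempotents with respect to the
partial order `f ≤ e ↔ f * e = f ∧ e * f = f`. -/
def IsPrimitiveIdempotent {S : Type u} [Semigroup S] (e : S) : Prop :=
  IsIdempotentElem e ∧ ∀ f : S, IsIdempotentElem f → f * e = f → e * f = f → f = e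

/-- A semigroup is completely simple if it is simple and contains a primitive idempotent. -/
def IsCompletelySimple (S : Type u) [Semigroup S] : Prop :=
  IsSimpleSemigroup S ∧ ∃ e : S, IsPrimitiveIdempotent e

/-- A space is pseudocompact if it is Tychonoff and all its continuous real-valued functions are
bounded. -/
def IsPseudocompact (X : Type u) [TopologicalSpace X] : Prop :=
  T35Space X ∧ ∀ f : X → ℝ, Continuous f → ∃ C : ℝ, ∀ x, |f x| ≤ C

/-- The Rees product `[X, H, Y]_σ` of `H` over `X` and `Y` relative to the sandwich map `σ`; its
underlying set is `X × H × Y`. -/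
def ReesProduct {X : Type u} {H : Type v} {Y : Type w} (_σ : Y × X → H) : Type (max u v w) :=
  X × H × Y

/-- The multiplication `(x, h, y) * (x', h', y') = (x, h * σ (y, x') * h', y')`. -/
instance ReesProduct.instSemigroup {X : Type u} {H : Type v} {Y : Type w} [Group H]
    (σ : Y × X → H) : Semigroup (ReesProduct σ) where
  mul a b := (a.1, a.2.1 * σ (a.2.2, b.1) * b.2.1, b.2.2)
  mul_assoc a b c := by
    refine Prod.ext rfl (Prod.ext ?_ rfl)
    change a.2.1 * σ (a.2.2, b.1) * b.2.1 * σ (b.2.2, c.1) * c.2.1 =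
      a.2.1 * σ (a.2.2, b.1) * (b.2.1 * σ (b.2.2, c.1) * c.2.1)
    simp only [mul_assoc]

/-- The Rees product carries the product topology. -/
instance ReesProduct.instTopologicalSpace {X : Type u} {H : Type v} {Y : Type w}
    [TopologicalSpace X] [TopologicalSpace H] [TopologicalSpace Y] (σ : Y × X → H) :
    TopologicalSpace (ReesProduct σ) :=
  inferInstanceAs (TopologicalSpace (X × H × Y))

/-- A semigroup with a topology is a topological paragroup if it is topologically isomorphic to a
Rees product `[X, H, Y]_σ` of a (Hausdorff) topological group `H` over (Hausdorff) topological
spaces `X`, `Y` with a continuous sandwich map `σ : Y × X → H`. -/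
def IsTopologicalParagroup (S : Type u) [Semigroup S] [TopologicalSpace S] : Prop :=
  ∃ (X H Y : Type u) (_ : TopologicalSpace X) (_ : T2Space X) (_ : TopologicalSpace H)
    (_ : T2Space H) (_ : TopologicalSpace Y) (_ : T2Space Y)
    (_ : Group H) (_ : IsTopologicalGroup H) (σ : Y × X → H),
    Continuous σ ∧ Nonempty (S ≃ₜ* ReesProduct σ)

/-- The given multiplication and topology of `T` are those of a topological group. -/
def FormsTopologicalGroup (T : Type u) [inst : Semigroup T] [TopologicalSpace T] : Prop :=
  ∃ G : Group T, G.toDivInvMonoid.toMonoid.toSemigroup = inst ∧ IsTopologicalGroup T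

/-!
In a completely simple semigroup every idempotent `e` is primitive, and this makes `eSe` a group.
With `g` the inverse of `e * s * e` in that group, `s ↦ (s * g, e * s * e, g * s)` are Rees
coordinates on `S`; they form a homeomorphism as soon as inversion in `eSe` is continuous.

Continuity of the inversion comes from compactness: `eSe` is the image of `S` under
`s ↦ e * s * e`, so it is a regular feebly compact group with continuous multiplication. If its
inversion were discontinuous, there would be a closed neighbourhood `K` of `1` such that `K⁻¹` is
not a neighbourhood of `1`. Then every nonempty open `U` contains an `x` with `¬ U ⊆ x • K`, and for
`V * V ⊆ K` the open set `U \ x • K` is disjoint from `W * V` for all small neighbourhoods `W` of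
`x`. Continuing inside `W` yields a locally finite sequence of nonempty open sets.
-/

open Filter Function Set Topology
open scoped Pointwise

section SimpleSemigroups

variable {S : Type u} [Semigroup S]

theorem IsSimpleSemigroup.exists_mul_mul_eq (hS : IsSimpleSemigroup S) (a s : S) :
    ∃ x y, x * a * y = s := by
  suffices {t | ∃ x y, x * a * y = t} = univ from this.superset (mem_univ s)
  refine hS _ ⟨a * a * a, a, a, rfl⟩ ?_
  rintro t _ ⟨x, y, rfl⟩
  exact ⟨⟨t * x, y, by simp only [mul_assoc]⟩, ⟨x, y * t, by simp only [mul_assoc]⟩⟩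

theorem IsPrimitiveIdempotent.exists_mul_eq (hS : IsSimpleSemigroup S) {e : S}
    (he : IsPrimitiveIdempotent e) {a : S} (ha : a ∈ Subsemigroup.corner e) :
    ∃ b ∈ Subsemigroup.corner e, a * b = e := by
  obtain ⟨hee, he_min⟩ := he
  have hee' : e * e = e := hee
  obtain ⟨hea, hae⟩ := (Subsemigroup.mem_corner_iff hee).1 ha
  obtain ⟨x, y, hxy⟩ := hS.exists_mul_mul_eq a e
  obtain ⟨p, q, hep, hpe, heq, hpaq⟩ :
      ∃ p q, e * p = p ∧ p * e = p ∧ e * q = q ∧ p * a * q = e :=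
    ⟨e * x * e, e * y, by grind, by grind, by grind, by grind⟩
  have h_idem : IsIdempotentElem (a * (q * p)) :=
    calc a * (q * p) * (a * (q * p)) = a * (q * (p * a * q * p)) := by simp only [mul_assoc]
      _ = a * (q * p) := by rw [hpaq, hep]
  have h_mem : q * p ∈ Subsemigroup.corner e :=
    (Subsemigroup.mem_corner_iff hee).2 ⟨by rw [← mul_assoc, heq], by rw [mul_assoc, hpe]⟩
  exact ⟨q * p, h_mem,
    he_min _ h_idem (by simp only [mul_assoc, hpe]) (by rw [← mul_assoc, hea])⟩

theorem IsCompletelySimple.isPrimitiveIdempotent (hS : IsCompletelySimple S) {f : S}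
    (hf : IsIdempotentElem f) : IsPrimitiveIdempotent f := by
  obtain ⟨h_simple, e, he, he_min⟩ := hS
  obtain ⟨p, q, hpe, heq, hpq⟩ : ∃ p q, p * e = p ∧ e * q = q ∧ p * q = f := by
    obtain ⟨x, y, hxy⟩ := h_simple.exists_mul_mul_eq e f
    exact ⟨x * e, e * y, by rw [mul_assoc, he.eq], by rw [← mul_assoc, he.eq],
      by rw [← hxy, mul_assoc x, ← mul_assoc e, he.eq, ← mul_assoc]⟩
  refine ⟨hf, fun g hg hgf hfg => ?_⟩
  -- `g ↦ q * g * p` transports idempotents below `f` to idempotents below `e`.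
  have h_idem : IsIdempotentElem (q * g * p) :=
    calc q * g * p * (q * g * p) = q * (g * (p * q)) * g * p := by simp only [mul_assoc]
      _ = q * g * p := by rw [hpq, hgf, mul_assoc q, hg.eq]
  have hqgp : q * g * p = e :=
    he_min _ h_idem (by rw [mul_assoc, hpe]) (by simp only [← mul_assoc, heq])
  calc g = (p * q) * g * (p * q) := by rw [hpq, hfg, hgf]
    _ = p * (q * g * p) * q := by simp only [mul_assoc]
    _ = f := by rw [hqgp, hpe, hpq]

theorem IsCompletelySimple.of_mulEquiv {T : Type v} [Semigroup T] (φ : S ≃* T)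
    (hT : IsCompletelySimple T) : IsCompletelySimple S := by
  obtain ⟨h_simple, e, he, he_min⟩ := hT
  refine ⟨fun I hI hmul => ?_, φ.symm e, he.map φ.symm, fun f hf hfe hef => ?_⟩
  · have h_preimage : φ.symm ⁻¹' I = univ :=
      h_simple _ (hI.preimage φ.symm.surjective) fun s a ha => by
        simpa only [mem_preimage, map_mul] using hmul (φ.symm s) _ ha
    exact φ.symm.surjective.preimage_injective (by rw [h_preimage, preimage_univ])
  · rw [← φ.apply_eq_iff_eq, map_mul, φ.apply_symm_apply] at hfe hef
    rw [φ.eq_symm_apply]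
    exact he_min _ (hf.map φ) hfe hef

end SimpleSemigroups

namespace ReesProduct

variable {X : Type u} {H : Type v} {Y : Type w} [Group H] {σ : Y × X → H}

theorem isIdempotentElem_iff {a : ReesProduct σ} :
    IsIdempotentElem a ↔ a.2.1 = (σ (a.2.2, a.1))⁻¹ := by
  rw [eq_inv_iff_mul_eq_one, ← mul_eq_right (b := a.2.1)]
  exact ⟨congrArg fun t : ReesProduct σ => t.2.1, fun h => Prod.ext rfl (Prod.ext h rfl)⟩

variable (σ)

theorem isSimpleSemigroup : IsSimpleSemigroup (ReesProduct σ) := by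
  rintro I ⟨a, ha⟩ hI
  refine eq_univ_of_forall fun t => ?_
  let g : H := σ (t.2.2, a.1) * a.2.1 * σ (a.2.2, t.1)
  let l : ReesProduct σ := (t.1, t.2.1 * g⁻¹, t.2.2)
  let r : ReesProduct σ := (t.1, 1, t.2.2)
  have h_middle : t.2.1 * g⁻¹ * σ (t.2.2, a.1) * a.2.1 * σ (a.2.2, t.1) * 1 = t.2.1 := by
    simp only [g]
    group
  have h_eq : l * a * r = t := Prod.ext rfl (Prod.ext h_middle rfl)
  exact h_eq ▸ (hI r _ (hI l a ha).1).2

theorem isCompletelySimple [Nonempty (ReesProduct σ)] : IsCompletelySimple (ReesProduct σ) := by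
  obtain ⟨x, -, y⟩ := ‹Nonempty (ReesProduct σ)›
  refine ⟨isSimpleSemigroup σ, (x, (σ (y, x))⁻¹, y), isIdempotentElem_iff.2 rfl, ?_⟩
  rintro ⟨x', h, y'⟩ hf hfe hef
  obtain rfl : y = y' := congrArg (fun t => t.2.2) hfe
  obtain rfl : x = x' := congrArg (fun t => t.1) hef
  exact Prod.ext rfl (Prod.ext (isIdempotentElem_iff.1 hf) rfl)

end ReesProduct

theorem IsTopologicalParagroup.isCompletelySimple {S : Type u} [Semigroup S] [TopologicalSpace S]
    [Nonempty S] (hS : IsTopologicalParagroup S) : IsCompletelySimple S := by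
  obtain ⟨X, H, Y, _, _, _, _, _, _, _, _, σ, -, ⟨φ⟩⟩ := hS
  have : Nonempty (ReesProduct σ) := Nonempty.map φ inferInstance
  exact (ReesProduct.isCompletelySimple σ).of_mulEquiv φ.toMulEquiv

section Corner

variable {S : Type u} [Semigroup S]

/-- The map `s ↦ e * s * e` onto the corner of `e`; it is a retraction when `e` is idempotent. -/
def toCorner (e s : S) : Subsemigroup.corner e :=
  ⟨e * s * e, s, rfl⟩

theorem toCorner_surjective {e : S} (he : IsIdempotentElem e) : Surjective (toCorner e) := by
  intro a
  obtain ⟨hea, hae⟩ := (Subsemigroup.mem_corner_iff he).1 a.2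
  exact ⟨a, Subtype.ext (by simp only [toCorner, hea, hae])⟩

@[fun_prop]
theorem continuous_toCorner [TopologicalSpace S] [ContinuousMul S] (e : S) :
    Continuous (toCorner e) := by
  unfold toCorner
  fun_prop

end Corner

/-- The idempotents `𝓛`-equivalent to the idempotent `e` (generating the same left ideal); the two
equations imply `x * x = x`. They form the factor `X` of the Rees coordinates at `e`. -/
def idempotentsL {S : Type u} [Semigroup S] (e : S) : Set S :=
  {x | x * e = x ∧ e * x = e}

/-- The idempotents `𝓡`-equivalent to the idempotent `e` (generating the same right ideal); the two
equations imply `y * y = y`. They form the factor `Y` of the Rees coordinates at `e`. -/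
def idempotentsR {S : Type u} [Semigroup S] (e : S) : Set S :=
  {y | e * y = y ∧ y * e = e}

namespace IsCompletelySimple

variable {S : Type u} [Semigroup S] (hS : IsCompletelySimple S) {e : S} (he : IsIdempotentElem e)

/-- The maximal subgroup of a completely simple semigroup at an idempotent `e`. It is a type synonym
of the corner of `e` which remembers the two hypotheses, so that it can carry a `Group` instance. -/
@[nolint unusedArguments]
def MaximalSubgroup (_hS : IsCompletelySimple S) {e : S} (_he : IsIdempotentElem e) : Type u :=
  Subsemigroup.corner e

theorem exists_mul_eq (hS : IsCompletelySimple S) {e : S} (he : IsIdempotentElem e) {a : S}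
    (ha : a ∈ Subsemigroup.corner e) : ∃ b ∈ Subsemigroup.corner e, a * b = e :=
  (hS.isPrimitiveIdempotent he).exists_mul_eq hS.1 ha

namespace MaximalSubgroup

instance : Semigroup (hS.MaximalSubgroup he) :=
  inferInstanceAs (Semigroup (Subsemigroup.corner e))

instance : One (hS.MaximalSubgroup he) :=
  ⟨⟨e, (Subsemigroup.mem_corner_iff he).2 ⟨he, he⟩⟩⟩

noncomputable instance : Inv (hS.MaximalSubgroup he) :=
  ⟨fun a => ⟨(hS.exists_mul_eq he a.2).choose, (hS.exists_mul_eq he a.2).choose_spec.1⟩⟩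

noncomputable instance : Group (hS.MaximalSubgroup he) :=
  Group.ofRightAxioms mul_assoc
    (fun a => Subtype.ext ((Subsemigroup.mem_corner_iff he).1 a.2).2)
    (fun a => Subtype.ext (hS.exists_mul_eq he a.2).choose_spec.2)

variable {hS he} (a b : hS.MaximalSubgroup he)

theorem val_mul : (a * b).1 = a.1 * b.1 := rfl

theorem idem_mul_val : e * a.1 = a.1 :=
  ((Subsemigroup.mem_corner_iff he).1 a.2).1

theorem val_mul_idem : a.1 * e = a.1 :=
  ((Subsemigroup.mem_corner_iff he).1 a.2).2

theorem val_mul_val_inv : a.1 * a⁻¹.1 = e :=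
  congrArg Subtype.val (mul_inv_cancel a)

theorem val_inv_mul_val : a⁻¹.1 * a.1 = e :=
  congrArg Subtype.val (inv_mul_cancel a)

end MaximalSubgroup

/-- The retraction `s ↦ e * s * e` of a completely simple semigroup onto its maximal subgroup at
`e`: the middle Rees coordinate. -/
def toMaximalSubgroup (s : S) : hS.MaximalSubgroup he :=
  toCorner e s

/-- The sandwich map `(y, x) ↦ y * x` of the Rees coordinates at `e`. -/
def sandwich (p : idempotentsR e × idempotentsL e) : hS.MaximalSubgroup he :=
  ⟨p.1 * p.2, (Subsemigroup.mem_corner_iff he).2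
    ⟨by rw [← mul_assoc, p.1.2.1], by rw [mul_assoc, p.2.2.1]⟩⟩

local notation "ρ" => hS.toMaximalSubgroup he

theorem toMaximalSubgroup_val (s : S) : (ρ s).1 = e * s * e :=
  rfl

theorem idem_mul_mul_inv (s : S) : e * s * (ρ s)⁻¹.1 = e :=
  calc e * s * (ρ s)⁻¹.1 = (ρ s).1 * (ρ s)⁻¹.1 := by
        rw [toMaximalSubgroup_val, mul_assoc _ e, MaximalSubgroup.idem_mul_val]
    _ = e := MaximalSubgroup.val_mul_val_inv _

theorem inv_mul_mul_idem (s : S) : (ρ s)⁻¹.1 * (s * e) = e :=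
  calc (ρ s)⁻¹.1 * (s * e) = (ρ s)⁻¹.1 * (ρ s).1 := by
        rw [toMaximalSubgroup_val, mul_assoc e, ← mul_assoc _ e, MaximalSubgroup.val_mul_idem]
    _ = e := MaximalSubgroup.val_inv_mul_val _

theorem mul_inv_mul_self (s : S) : s * (ρ s)⁻¹.1 * s = s := by
  obtain ⟨x, y, rfl⟩ := hS.1.exists_mul_mul_eq e s
  have h_factor : ρ (x * e * y) = ρ x * ρ y := Subtype.ext <| by
    simp only [MaximalSubgroup.val_mul, toMaximalSubgroup_val, mul_assoc, he.mul_self_mul]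
  rw [h_factor, mul_inv_rev, MaximalSubgroup.val_mul]
  calc x * e * y * ((ρ y)⁻¹.1 * (ρ x)⁻¹.1) * (x * e * y)
      = x * (e * y * (ρ y)⁻¹.1) * ((ρ x)⁻¹.1 * (x * e)) * y := by simp only [mul_assoc]
    _ = x * e * y := by rw [idem_mul_mul_inv, inv_mul_mul_idem, mul_assoc x, he.eq]

theorem mul_inv_mem_idempotentsL (s : S) : s * (ρ s)⁻¹.1 ∈ idempotentsL e :=
  ⟨by rw [mul_assoc, MaximalSubgroup.val_mul_idem], by rw [← mul_assoc, idem_mul_mul_inv]⟩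

theorem inv_mul_mem_idempotentsR (s : S) : (ρ s)⁻¹.1 * s ∈ idempotentsR e :=
  ⟨by rw [← mul_assoc, MaximalSubgroup.idem_mul_val], by rw [mul_assoc, inv_mul_mul_idem]⟩

variable {hS he}

theorem toMaximalSubgroup_mul_mul (x : idempotentsL e) (h : hS.MaximalSubgroup he)
    (y : idempotentsR e) : ρ (x * h.1 * y) = h := Subtype.ext <|
  calc e * (x * h.1 * y) * e = e * x * h.1 * (y * e) := by simp only [mul_assoc]
    _ = h.1 := by rw [x.2.2, y.2.2, MaximalSubgroup.idem_mul_val, MaximalSubgroup.val_mul_idem]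

theorem mul_mul_mul_inv (x : idempotentsL e) (h : hS.MaximalSubgroup he) (y : idempotentsR e) :
    x * h.1 * y * h⁻¹.1 = x :=
  calc x * h.1 * y * h⁻¹.1 = x * h.1 * (y * e * h⁻¹.1) := by
        simp only [mul_assoc, MaximalSubgroup.idem_mul_val]
    _ = x := by
        rw [y.2.2, MaximalSubgroup.idem_mul_val, mul_assoc, MaximalSubgroup.val_mul_val_inv, x.2.1]

theorem inv_mul_mul_mul (x : idempotentsL e) (h : hS.MaximalSubgroup he) (y : idempotentsR e) :
    h⁻¹.1 * (x * h.1 * y) = y :=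
  calc h⁻¹.1 * (x * h.1 * y) = h⁻¹.1 * (e * x) * h.1 * y := by
        simp only [← mul_assoc, MaximalSubgroup.val_mul_idem]
    _ = y := by
        rw [x.2.2, MaximalSubgroup.val_mul_idem, MaximalSubgroup.val_inv_mul_val, y.2.1]

theorem mul_inv_mul_toMaximalSubgroup_mul (s : S) :
    s * (ρ s)⁻¹.1 * (ρ s).1 * ((ρ s)⁻¹.1 * s) = s :=
  calc s * (ρ s)⁻¹.1 * (ρ s).1 * ((ρ s)⁻¹.1 * s) = s * ((ρ s)⁻¹.1 * (ρ s).1 * (ρ s)⁻¹.1) * s := by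
        simp only [mul_assoc]
    _ = s := by
        rw [MaximalSubgroup.val_inv_mul_val, MaximalSubgroup.idem_mul_val, mul_inv_mul_self]

variable (hS he)

/-- The Rees coordinates of a completely simple semigroup at an idempotent `e`: an element `s` has
coordinates `(s * g, e * s * e, g * s)`, where `g` is the inverse of `e * s * e` in the maximal
subgroup at `e`. -/
noncomputable def reesMulEquiv : ReesProduct (hS.sandwich he) ≃* S where
  toFun p := p.1 * p.2.1.1 * p.2.2
  invFun s := (⟨s * (ρ s)⁻¹.1, hS.mul_inv_mem_idempotentsL he s⟩, ρ s,
    ⟨(ρ s)⁻¹.1 * s, hS.inv_mul_mem_idempotentsR he s⟩)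
  left_inv := by
    rintro ⟨x, h, y⟩
    have h_mid : ρ (x * h.1 * y) = h := toMaximalSubgroup_mul_mul x h y
    refine Prod.ext (Subtype.ext ?_) (Prod.ext h_mid (Subtype.ext ?_))
    · simpa only [h_mid] using mul_mul_mul_inv x h y
    · simpa only [h_mid] using inv_mul_mul_mul x h y
  right_inv := mul_inv_mul_toMaximalSubgroup_mul
  map_mul' p q := by
    change p.1 * (p.2.1.1 * (p.2.2 * q.1) * q.2.1.1) * q.2.2 = _
    simp only [mul_assoc]

section Topology

variable [TopologicalSpace S]

instance : TopologicalSpace (hS.MaximalSubgroup he) :=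
  inferInstanceAs (TopologicalSpace (Subsemigroup.corner e))

instance [T2Space S] : T2Space (hS.MaximalSubgroup he) :=
  inferInstanceAs (T2Space (Subsemigroup.corner e))

variable [ContinuousMul S]

instance : ContinuousMul (hS.MaximalSubgroup he) :=
  inferInstanceAs (ContinuousMul (Subsemigroup.corner e))

@[fun_prop]
theorem continuous_toMaximalSubgroup : Continuous (hS.toMaximalSubgroup he) :=
  continuous_toCorner e

theorem continuous_sandwich : Continuous (hS.sandwich he) :=
  Continuous.subtype_mk (by fun_prop) _

theorem continuous_reesMulEquiv : Continuous (hS.reesMulEquiv he) := by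
  change Continuous fun p : idempotentsL e × Subsemigroup.corner e × idempotentsR e =>
    (p.1 : S) * p.2.1 * p.2.2
  fun_prop

theorem continuous_reesMulEquiv_symm [IsTopologicalGroup (hS.MaximalSubgroup he)] :
    Continuous (hS.reesMulEquiv he).symm := by
  have h_inv : Continuous fun s => (ρ s)⁻¹.1 := continuous_subtype_val.comp (by fun_prop)
  exact ((continuous_id.mul h_inv).subtype_mk _).prodMk
    ((hS.continuous_toMaximalSubgroup he).prodMk ((h_inv.mul continuous_id).subtype_mk _))

theorem isTopologicalParagroup [T2Space S] [IsTopologicalGroup (hS.MaximalSubgroup he)] :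
    IsTopologicalParagroup S :=
  ⟨idempotentsL e, hS.MaximalSubgroup he, idempotentsR e, inferInstance, inferInstance,
    inferInstance, inferInstance, inferInstance, inferInstance, inferInstance, inferInstance,
    hS.sandwich he, hS.continuous_sandwich he,
    ⟨.symm { hS.reesMulEquiv he with
      continuous_toFun := hS.continuous_reesMulEquiv he
      continuous_invFun := hS.continuous_reesMulEquiv_symm he }⟩⟩

end Topology

end IsCompletelySimple

/-- A space is feebly compact if it has no locally finite sequence of nonempty open sets. Among
Tychonoff spaces this is pseudocompactness, but it needs no real-valued functions. -/
def IsFeeblyCompact (X : Type u) [TopologicalSpace X] : Prop :=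
  ∀ O : ℕ → Set X, (∀ n, IsOpen (O n)) → (∀ n, (O n).Nonempty) → ¬ LocallyFinite O

section FeeblyCompact

variable {X : Type u} [TopologicalSpace X]

theorem IsFeeblyCompact.of_surjective {Y : Type v} [TopologicalSpace Y] (hX : IsFeeblyCompact X)
    {f : X → Y} (hf : Continuous f) (hf_surj : Surjective f) : IsFeeblyCompact Y :=
  fun O ho hne hlf => hX (fun n => f ⁻¹' O n) (fun n => (ho n).preimage hf)
    (fun n => (hne n).preimage hf_surj) (hlf.preimage_continuous hf)

theorem IsFeeblyCompact.exists_forall_abs_le (hX : IsFeeblyCompact X) {f : X → ℝ}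
    (hf : Continuous f) : ∃ C : ℝ, ∀ x, |f x| ≤ C := by
  by_contra! h_unbounded
  refine hX (fun n => {x | n < |f x|}) (fun n => isOpen_lt continuous_const hf.abs)
    (fun n => h_unbounded n) fun x => ?_
  refine ⟨{y | |f y| < |f x| + 1},
    (isOpen_lt hf.abs continuous_const).mem_nhds (lt_add_one |f x|), ?_⟩
  obtain ⟨N, hN⟩ := exists_nat_gt (|f x| + 1)
  refine (finite_lt_nat N).subset ?_
  rintro n ⟨y, hny, hyx⟩
  exact Nat.cast_lt.1 ((hny.trans hyx).trans hN)

theorem exists_continuous_nonneg_eq_support_subset [CompletelyRegularSpace X] {U : Set X}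
    (hU : IsOpen U) {x : X} (hx : x ∈ U) {c : ℝ} (hc : 0 ≤ c) :
    ∃ f : X → ℝ, Continuous f ∧ 0 ≤ f ∧ f x = c ∧ support f ⊆ U := by
  obtain ⟨f, hf, hfx, hfU⟩ := CompletelyRegularSpace.completely_regular_isOpen x U hU hx
  refine ⟨fun y => c * (1 - f y), by fun_prop,
    fun y => mul_nonneg hc (sub_nonneg.2 (f y).2.2), by simp [hfx], support_subset_iff'.2 ?_⟩
  intro y hy
  simp [hfU hy]

theorem IsPseudocompact.isFeeblyCompact (hX : IsPseudocompact X) : IsFeeblyCompact X := by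
  obtain ⟨_, h_bdd⟩ := hX
  intro O ho hne hlf
  choose x hx using hne
  -- bumps of height `n` supported in `O n` add up to an unbounded continuous function
  choose f hf hf_nonneg hfx hfO using fun n =>
    exists_continuous_nonneg_eq_support_subset (ho n) (hx n) n.cast_nonneg
  have hlf_support : LocallyFinite fun n => support (f n) := hlf.subset hfO
  obtain ⟨C, hC⟩ := h_bdd _ (continuous_finsum hf hlf_support)
  obtain ⟨n, hn⟩ := exists_nat_gt C
  refine hn.not_ge ?_
  calc (n : ℝ) = f n (x n) := (hfx n).symm
    _ ≤ ∑ᶠ i, f i (x n) :=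
      single_le_finsum n (hlf_support.point_finite (x n)) fun i => hf_nonneg i _
    _ ≤ C := (le_abs_self _).trans (hC (x n))

theorem isPseudocompact_iff : IsPseudocompact X ↔ T35Space X ∧ IsFeeblyCompact X :=
  ⟨fun h => ⟨h.1, h.isFeeblyCompact⟩, fun h => ⟨h.1, fun _ => h.2.exists_forall_abs_le⟩⟩

theorem IsFeeblyCompact.corner [Semigroup X] [ContinuousMul X] (hX : IsFeeblyCompact X) {e : X}
    (he : IsIdempotentElem e) : IsFeeblyCompact (Subsemigroup.corner e) :=
  hX.of_surjective (continuous_toCorner e) (toCorner_surjective he)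

end FeeblyCompact

section ParatopologicalGroups

variable {G : Type u} [Group G] [TopologicalSpace G]

theorem exists_mem_not_subset_smul [SeparatelyContinuousMul G] {K U : Set G}
    (hK : K⁻¹ ∉ 𝓝 (1 : G)) (hU : IsOpen U) (hne : U.Nonempty) : ∃ x ∈ U, ¬ U ⊆ x • K := by
  by_contra! h_subset
  obtain ⟨v, hv⟩ := hne
  have h_nhds : (v * ·) ⁻¹' U ∈ 𝓝 (1 : G) :=
    (hU.preimage (continuous_const_mul v)).mem_nhds (by simpa using hv)
  refine hK (mem_of_superset h_nhds fun z hz => ?_)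
  simpa [mem_smul_set_iff_inv_smul_mem] using h_subset _ hz hv

theorem locallyFinite_of_disjoint_mul [SeparatelyContinuousMul G] {V : Set G}
    (hV : V ∈ 𝓝 (1 : G)) {U O : ℕ → Set G} (hU : ∀ n, closure (U (n + 1)) ⊆ U n)
    (hOU : ∀ n, O n ⊆ U n) (hd : ∀ n, Disjoint (O n) (U (n + 1) * V)) : LocallyFinite O := by
  have h_anti : Antitone U := antitone_nat_of_succ_le fun n => subset_closure.trans (hU n)
  intro p
  by_cases hp : ∀ n, p ∈ U n
  · refine ⟨p • V, by simpa using smul_mem_nhds_smul p hV, ?_⟩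
    convert finite_empty
    refine eq_empty_of_forall_notMem ?_
    rintro n ⟨z, hzO, hzV⟩
    exact (hd n).notMem_of_mem_left hzO (smul_set_subset_mul (hp (n + 1)) hzV)
  · push Not at hp
    obtain ⟨n, hn⟩ := hp
    refine ⟨(closure (U (n + 1)))ᶜ,
      isClosed_closure.isOpen_compl.mem_nhds fun h => hn (hU n h), ?_⟩
    refine (finite_lt_nat (n + 1)).subset ?_
    rintro m ⟨z, hzO, hzU⟩
    by_contra h_le
    exact hzU (subset_closure (h_anti (not_lt.1 h_le) (hOU m hzO)))

variable [ContinuousMul G] [RegularSpace G]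

theorem exists_isOpen_disjoint_mul {V K : Set G} (hV : V ∈ 𝓝 (1 : G))
    (hK : IsClosed K) (hVK : V * V ⊆ K) (hK_inv : K⁻¹ ∉ 𝓝 (1 : G)) {U : Set G}
    (hU : IsOpen U) (hne : U.Nonempty) :
    ∃ O W : Set G, (IsOpen O ∧ O.Nonempty ∧ O ⊆ U) ∧ (IsOpen W ∧ W.Nonempty ∧ closure W ⊆ U) ∧
      Disjoint O (W * V) := by
  obtain ⟨x, hxU, hx⟩ := exists_mem_not_subset_smul hK_inv hU hne
  have h_nhds : U ∩ x • V ∈ 𝓝 x :=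
    inter_mem (hU.mem_nhds hxU) (by simpa using smul_mem_nhds_smul x hV)
  obtain ⟨F, hF, hF_closed, hFU⟩ := exists_mem_nhds_isClosed_subset h_nhds
  have hWF : closure (interior F) ⊆ F := hF_closed.closure_interior_subset
  have hWVK : interior F * V ⊆ x • K :=
    calc interior F * V ⊆ x • V * V := mul_subset_mul_right
          (interior_subset.trans (hFU.trans inter_subset_right))
      _ = x • (V * V) := smul_mul_assoc x V V
      _ ⊆ x • K := smul_set_mono hVK
  exact ⟨U \ x • K, interior F,
    ⟨hU.sdiff (hK.smul x), sdiff_nonempty.2 hx, sdiff_subset⟩,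
    ⟨isOpen_interior, ⟨x, mem_interior_iff_mem_nhds.2 hF⟩,
      hWF.trans (hFU.trans inter_subset_left)⟩,
    disjoint_sdiff_left.mono_right hWVK⟩

theorem IsFeeblyCompact.tendsto_inv_nhds_one (hG : IsFeeblyCompact G) :
    Tendsto (fun x : G => x⁻¹) (𝓝 1) (𝓝 1) := by
  refine (closed_nhds_basis (1 : G)).tendsto_right_iff.2 fun K ⟨hK, hK_closed⟩ => ?_
  by_contra hK_inv
  obtain ⟨V, hV_open, hV1, hVK⟩ := exists_open_nhds_one_mul_subset hK
  have hV : V ∈ 𝓝 1 := hV_open.mem_nhds hV1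
  choose O W hO hW hd using fun U : {U : Set G // IsOpen U ∧ U.Nonempty} =>
    exists_isOpen_disjoint_mul hV hK_closed hVK hK_inv U.2.1 U.2.2
  let U : ℕ → {U : Set G // IsOpen U ∧ U.Nonempty} := fun n =>
    n.rec ⟨univ, isOpen_univ, univ_nonempty⟩ fun _ U => ⟨W U, (hW U).1, (hW U).2.1⟩
  have hU : ∀ n, closure (U (n + 1)).1 ⊆ (U n).1 := fun n => (hW (U n)).2.2
  have hOU : ∀ n, Disjoint (O (U n)) ((U (n + 1)).1 * V) := fun n => hd (U n)
  exact hG (fun n => O (U n)) (fun n => (hO _).1) (fun n => (hO _).2.1)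
    (locallyFinite_of_disjoint_mul hV hU (fun n => (hO _).2.2) hOU)

theorem IsFeeblyCompact.isTopologicalGroup (hG : IsFeeblyCompact G) :
    IsTopologicalGroup G where
  toContinuousInv := .of_nhds_one hG.tendsto_inv_nhds_one
    (fun x => by
      simpa only [Homeomorph.coe_mulLeft, mul_one] using
        ((Homeomorph.mulLeft x).map_nhds_eq (1 : G)).symm)
    fun x => by
      have h_conj : Continuous fun y : G => x * y * x⁻¹ := by fun_prop
      simpa using h_conj.tendsto 1

end ParatopologicalGroups

theorem IsFeeblyCompact.isTopologicalGroup_maximalSubgroup {S : Type u} [Semigroup S]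
    [TopologicalSpace S] [ContinuousMul S] [RegularSpace S] (hS : IsFeeblyCompact S)
    (hcs : IsCompletelySimple S) {e : S} (he : IsIdempotentElem e) :
    IsTopologicalGroup (hcs.MaximalSubgroup he) :=
  haveI : RegularSpace (hcs.MaximalSubgroup he) :=
    inferInstanceAs (RegularSpace (Subsemigroup.corner e))
  IsFeeblyCompact.isTopologicalGroup (hS.corner he)

theorem mainTheorem4_general {S : Type u} [Nonempty S] [Semigroup S] [TopologicalSpace S]
    [ContinuousMul S] [T3Space S] (hS : IsFeeblyCompact S) :
    (IsTopologicalParagroup S ↔ IsCompletelySimple S) ∧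
    (IsCompletelySimple S → ∀ e : S, IsIdempotentElem e →
      IsFeeblyCompact (Subsemigroup.corner e) ∧
      FormsTopologicalGroup (Subsemigroup.corner e)) := by
  refine ⟨⟨IsTopologicalParagroup.isCompletelySimple, fun hcs => ?_⟩, fun hcs e he => ?_⟩
  · obtain ⟨e, he, -⟩ := hcs.2
    have := hS.isTopologicalGroup_maximalSubgroup hcs he
    exact hcs.isTopologicalParagroup he
  · exact ⟨hS.corner he, (inferInstance : Group (hcs.MaximalSubgroup he)), rfl,
      hS.isTopologicalGroup_maximalSubgroup hcs he⟩

theorem mainTheorem4 {S : Type u} [Nonempty S] [Semigroup S] [TopologicalSpace S]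
    [ContinuousMul S] (hS : IsPseudocompact S) :
    (IsTopologicalParagroup S ↔ IsCompletelySimple S) ∧
    (IsCompletelySimple S → ∀ e : S, IsIdempotentElem e →
      IsPseudocompact (Subsemigroup.corner e) ∧
      FormsTopologicalGroup (Subsemigroup.corner e)) := by
  have := hS.1
  exact (mainTheorem4_general hS.isFeeblyCompact).imp_right fun h hcs e he =>
    (h hcs e he).imp_left fun hc => isPseudocompact_iff.2 ⟨inferInstance, hc⟩
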